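/- Let $\mathcal A$ be a von Neumann algebra, i.e. a $*$-subalgebra of $B(H)$, for a complex Hilbert space $H$, that equals its double commutant. Let $\Pi(\mathcal A)$ be the complete lattice of projections (self-adjoint idempotents) of $\mathcal A$, ordered by $p\le q\iff pq=p$. Let $\mathcal V(\mathcal A)$ be the set of commutative von Neumann subalgebras (contexts) $A\subseteq\mathcal A$ with the same unit, ordered by inclusion, and let $\mathrm{Max}(A)$ be the Gelfand spectrum of $A$ (its characters, with the weak-$*$ topology). Let $\Sigma_*$ be the space of pairs $(A,\lambda)$ with $A\in\mathcal V(\mathcal A)$ and $\lambda\in\mathrm{Max}(A)$, in which $U$ is open iff every $U_A:=\{\lambda\in\mathrm{Max}(A)\mid (A,\lambda)\in U\}$ is open and, for $A\subseteq A'$ and $\lambda'\in\mathrm{Max}(A')$, $\lambda'|_A\in U_A$ implies $\lambda'\in U_{A'}$. Let $\Gamma\,\mathrm{Clopen}(\Sigma_*)$ be the set of open $D\subseteq\Sigma_*$ with every $D_A$ closed in $\mathrm{Max}(A)$, ordered by inclusion. Its finite meets and joins are intersections and unions. For $p\in\Pi(\mathcal A)$ and $A\in\mathcal V(\mathcal A)$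 let $\delta^i(p)_A:=\bigvee\{q\in\Pi(A)\mid q\le p\}$, and let $$\underline\delta^i(p):=\{(A,\lambda)\in\Sigma_*\mid \lambda(\delta^i(p)_A)=1\}\in\Gamma\,\mathrm{Clopen}(\Sigma_*).$$ **Theorem.** 1. The map $\underline\delta^i:\Pi(\mathcal A)\to\Gamma\,\mathrm{Clopen}(\Sigma_*)$ is injective and $p\le q\iff\underline\delta^i(p)\le\underline\delta^i(q)$. It preserves $0$, $1$, binary meets and arbitrary meets. 2. $\Gamma\,\mathrm{Clopen}(\Sigma_*)$ has all small meets. It is a distributive lattice, and binary joins distribute over arbitrary meets. 3. $\underline\delta^i(p\vee q)\ge\underline\delta^i(p)\vee\underline\delta^i(q)$ for all $p,q\in\Pi(\mathcal A)$. If $\mathcal A\ne\mathbb C\cdot 1$, then equality fails for some $p,q$. 4. Every $D\in\Gamma\,\mathrm{Clopen}(\Sigma_*)$ has a negation (pseudocomplement) $\neg D$, that is, $E\le\neg D\iff E\wedge D=\emptyset$ for all $E\in\Gamma\,\mathrm{Clopen}(\Sigma_*)$. If $\mathcal A$ is not commutative, then $\underline\delta^i$ does not preserve the negation: $\underline\delta^i(1-p)\ne\neg\underline\delta^i(p)$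 for some $p\in\Pi(\mathcal A)$. If $\mathcal A\neq\mathbb C\cdot 1$, then the law of the excluded middle fails: $D\vee\neg D\ne\Sigma_*$ for some $D$. 5. For each context $A$, $\underline\delta^i$ restricts to an order isomorphism $\Pi(A)\cong\{\text{clopen subsets of }\mathrm{Max}(A)\}$, $p\mapsto\underline\delta^i(p)_A=\{\lambda\in\mathrm{Max}(A)\mid\lambda(\delta^i(p)_A)=1\}$. -/

import Mathlib

noncomputable section

namespace TQL

variable {H : Type*} [NormedAddCommGroup H] [InnerProductSpace ℂ H] [CompleteSpace H]

/-! ### The projection lattice of a von Neumann algebra -/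

/-- A projection (self-adjoint idempotent) of the von Neumann algebra `M`. -/
@[ext]
structure Projection (M : VonNeumannAlgebra H) where
  /-- The underlying bounded operator. -/
  op : H →L[ℂ] H
  mem : op ∈ M
  isStarProjection : IsStarProjection op

namespace Projection

variable {M : VonNeumannAlgebra H}

/-- The order of projections: `p ≤ q` iff `p q = p`. -/
instance : LE (Projection M) := ⟨fun p q => p.op * q.op = p.op⟩

theorem le_def {p q : Projection M} : p ≤ q ↔ p.op * q.op = p.op := Iff.rfl

theorem mul_eq_of_le {p q : Projection M} (h : p ≤ q) : q.op * p.op = p.op := by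
  have h1 := congrArg star (le_def.1 h)
  rwa [star_mul, p.isStarProjection.isSelfAdjoint.star_eq,
    q.isStarProjection.isSelfAdjoint.star_eq] at h1

instance : PartialOrder (Projection M) where
  le_refl p := p.isStarProjection.isIdempotentElem
  le_trans p q r hpq hqr := by
    rw [le_def] at *
    rw [← hpq, mul_assoc, hqr]
  le_antisymm p q hpq hqp := by
    apply Projection.ext
    rw [← le_def.1 hpq]
    exact mul_eq_of_le hqp

/-- The projection of `M` onto the closed linear span of the ranges of the members of `S`. -/
def sup (S : Set (Projection M)) : Projection M where
  op := (⨆ q ∈ S, (q.op).range).topologicalClosure.starProjection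
  mem := by
    rw [VonNeumannAlgebra.IsStarProjection.mem_iff isStarProjection_starProjection]
    intro y hy
    rw [Submodule.range_starProjection, Module.End.mem_invtSubmodule]
    have h1 : (⨆ q ∈ S, (q.op).range) ≤
        (⨆ q ∈ S, (q.op).range).comap (y : H →ₗ[ℂ] H) := by
      refine iSup₂_le fun q hq => ?_
      have h2 := (VonNeumannAlgebra.IsStarProjection.mem_iff q.isStarProjection M).1 q.mem y hy
      rw [Module.End.mem_invtSubmodule] at h2
      exact h2.trans (Submodule.comap_mono (le_iSup₂_of_le q hq le_rfl))
    intro x hx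
    exact map_mem_closure y.continuous hx (fun a ha => h1 ha)
  isStarProjection := isStarProjection_starProjection

theorem apply_eq_iff_mem_range (p : Projection M) (x : H) : p.op x = x ↔ x ∈ (p.op).range := by
  constructor
  · intro h
    exact ⟨x, h⟩
  · rintro ⟨y, rfl⟩
    exact congrArg (fun T : H →L[ℂ] H => T y) p.isStarProjection.isIdempotentElem.eq

theorem le_iff_range_le {p q : Projection M} : p ≤ q ↔ (p.op).range ≤ (q.op).range := by
  constructor
  · rintro h _ ⟨y, rfl⟩
    exact ⟨p.op y, congrArg (fun T : H →L[ℂ] H => T y) (mul_eq_of_le h)⟩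
  · intro h
    have h1 : q.op * p.op = p.op := by
      ext y
      exact (q.apply_eq_iff_mem_range _).2 (h ⟨y, rfl⟩)
    have h2 := congrArg star h1
    rwa [star_mul, p.isStarProjection.isSelfAdjoint.star_eq,
      q.isStarProjection.isSelfAdjoint.star_eq] at h2

theorem isLUB_sup (S : Set (Projection M)) : IsLUB S (sup S) := by
  constructor
  · intro q hq
    rw [le_iff_range_le]
    change _ ≤ ((⨆ q ∈ S, (q.op).range).topologicalClosure.starProjection).range
    rw [Submodule.range_starProjection]
    have h1 : (q.op).range ≤ ⨆ q ∈ S, (q.op).range :=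
      le_iSup₂_of_le (f := fun (q : Projection M) (_ : q ∈ S) => (q.op).range) q hq le_rfl
    exact h1.trans (Submodule.le_topologicalClosure (⨆ q ∈ S, (q.op).range))
  · intro r hr
    rw [le_iff_range_le]
    change ((⨆ q ∈ S, (q.op).range).topologicalClosure.starProjection).range ≤ _
    rw [Submodule.range_starProjection]
    refine Submodule.topologicalClosure_minimal _
      (iSup₂_le fun q hq => le_iff_range_le.1 (hr hq)) ?_
    have h : ((r.op).range : Set H) = {x | r.op x = x} := by
      ext x
      exact (r.apply_eq_iff_mem_range x).symm
    rw [h]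
    exact isClosed_eq r.op.continuous continuous_id

instance : SupSet (Projection M) := ⟨sup⟩

/-- The complete lattice of projections of `M`; bottom is `0` and top is `1`. -/
instance : CompleteLattice (Projection M) where
  __ := completeLatticeOfSup (Projection M) isLUB_sup
  bot := ⟨0, zero_mem M, .zero _⟩
  bot_le p := zero_mul p.op
  top := ⟨1, one_mem M, .one _⟩
  le_top p := mul_one p.op

/-- The orthocomplement `1 - p`, the negation of quantum logic. -/
def ortho (p : Projection M) : Projection M where
  op := 1 - p.op
  mem := sub_mem (one_mem M) p.mem
  isStarProjection := p.isStarProjection.one_sub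

/-- A projection of a von Neumann subalgebra, seen in the larger algebra. -/
def incl {N : VonNeumannAlgebra H} (h : N ≤ M) (p : Projection N) : Projection M where
  op := p.op
  mem := h p.mem
  isStarProjection := p.isStarProjection

theorem le_of_forall_incl {N : VonNeumannAlgebra H} (h : N ≤ M) {S : Set (Projection N)}
    {p : Projection M} (hS : ∀ q ∈ S, incl h q ≤ p) : incl h (sSup S) ≤ p := by
  rw [le_iff_range_le]
  change ((⨆ q ∈ S, (q.op).range).topologicalClosure.starProjection).range ≤ _
  rw [Submodule.range_starProjection]
  refine Submodule.topologicalClosure_minimal _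
    (iSup₂_le fun q hq => le_iff_range_le.1 (hS q hq)) ?_
  have h : ((p.op).range : Set H) = {x | p.op x = x} := by
    ext x
    exact (p.apply_eq_iff_mem_range x).symm
  rw [h]
  exact isClosed_eq p.op.continuous continuous_id

end Projection

/-! ### Contexts and their Gelfand spectra -/

/-- A context of `M`: a commutative von Neumann subalgebra of `M` (with the same unit). -/
@[ext]
structure Context (M : VonNeumannAlgebra H) where
  /-- The underlying von Neumann algebra. -/
  alg : VonNeumannAlgebra H
  le : alg ≤ M
  comm : ∀ a ∈ alg, ∀ b ∈ alg, a * b = b * a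

namespace Context

variable {M : VonNeumannAlgebra H}

/-- Contexts are ordered by inclusion. -/
instance : PartialOrder (Context M) := PartialOrder.lift Context.alg fun _ _ => Context.ext

/-- The Gelfand spectrum of a context: its characters, with the weak-star topology. -/
abbrev Max (A : Context M) : Type _ :=
  WeakDual.characterSpace ℂ A.alg.toStarSubalgebra

/-- The value `λ(p)` of a character at a projection of the context. -/
def evalProj {A : Context M} (l : A.Max) (p : Projection A.alg) : ℂ :=
  l ⟨p.op, p.mem⟩

/-- The inclusion of a context into a larger one, as a continuous linear map. -/
def inclCLM {A B : Context M} (h : A ≤ B) :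
    A.alg.toStarSubalgebra →L[ℂ] B.alg.toStarSubalgebra where
  toFun a := ⟨a.1, h a.2⟩
  map_add' _ _ := rfl
  map_smul' _ _ := rfl
  cont := Continuous.subtype_mk continuous_subtype_val _

/-- Restriction of characters along an inclusion of contexts. -/
def restrict {A B : Context M} (h : A ≤ B) (l : B.Max) : A.Max :=
  ⟨StrongDual.toWeakDual ((WeakDual.CharacterSpace.toCLM l).comp (inclCLM h)), by
    refine ⟨fun h0 => ?_, fun x y => map_mul l (inclCLM h x) (inclCLM h y)⟩
    have h1 : l (inclCLM h 1) = 0 := congrArg (fun f : WeakDual ℂ _ => f 1) h0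
    have h2 : l (inclCLM h 1) = 1 := map_one l
    exact one_ne_zero (h2.symm.trans h1)⟩

theorem restrict_apply {A B : Context M} (h : A ≤ B) (l : B.Max)
    (a : A.alg.toStarSubalgebra) : restrict h l a = l ⟨a.1, h a.2⟩ := rfl

theorem continuous_evalProj {A : Context M} (p : Projection A.alg) :
    Continuous fun l : A.Max => evalProj l p :=
  (WeakDual.eval_continuous _).comp continuous_subtype_val

theorem evalProj_eq_zero_or_one {A : Context M} (l : A.Max) (p : Projection A.alg) :
    evalProj l p = 0 ∨ evalProj l p = 1 := by
  have h : evalProj l p * evalProj l p = evalProj l p := by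
    unfold evalProj
    rw [← map_mul]
    exact congrArg l (Subtype.ext p.isStarProjection.isIdempotentElem)
  rcases eq_or_ne (evalProj l p) 0 with h0 | h0
  · exact Or.inl h0
  · exact Or.inr (mul_left_cancel₀ h0 (h.trans (mul_one _).symm))

theorem isClopen_evalProj_eq_one {A : Context M} (p : Projection A.alg) :
    IsClopen {l : A.Max | evalProj l p = 1} := by
  refine ⟨isClosed_eq (continuous_evalProj p) continuous_const, ?_⟩
  have h : {l : A.Max | evalProj l p = 1} = {l : A.Max | evalProj l p ≠ 0} := by
    ext l
    rcases evalProj_eq_zero_or_one l p with h | h <;> simp [h]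
  rw [h]
  exact isOpen_ne_fun (continuous_evalProj p) continuous_const

end Context

/-! ### The covariant spectral bundle -/

/-- The points `(A, λ)` of the covariant spectral bundle of `M`. -/
structure SpectralBundle (M : VonNeumannAlgebra H) where
  /-- The context. -/
  ctx : Context M
  /-- The character of the context. -/
  char : ctx.Max

namespace SpectralBundle

variable {M : VonNeumannAlgebra H}

/-- The part of a subset of the bundle that lies in the spectrum of the context `A`. -/
def fiber (U : Set (SpectralBundle M)) (A : Context M) : Set A.Max :=
  {l | (⟨A, l⟩ : SpectralBundle M) ∈ U}

/-- `U` is open iff it is open in each spectrum and, for contexts `A ≤ B`, contains each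
character of `B` whose restriction to `A` it contains. -/
instance : TopologicalSpace (SpectralBundle M) where
  IsOpen U := (∀ A, IsOpen (fiber U A)) ∧
    ∀ (A B : Context M) (h : A ≤ B) (l : B.Max),
      Context.restrict h l ∈ fiber U A → l ∈ fiber U B
  isOpen_univ := ⟨fun _ => isOpen_univ, fun _ _ _ _ _ => trivial⟩
  isOpen_inter U V hU hV :=
    ⟨fun A => (hU.1 A).inter (hV.1 A),
      fun A B h l hl => ⟨hU.2 A B h l hl.1, hV.2 A B h l hl.2⟩⟩
  isOpen_sUnion S hS := by
    refine ⟨fun A => ?_, ?_⟩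
    · have h : fiber (⋃₀ S) A = ⋃ U ∈ S, fiber U A := by
        ext l
        simp [fiber]
      rw [h]
      exact isOpen_biUnion fun U hU => (hS U hU).1 A
    · rintro A B h l ⟨U, hU, hl⟩
      exact ⟨U, hU, (hS U hU).2 A B h l hl⟩

end SpectralBundle

open SpectralBundle in
/-- The lattice `Γ Clopen(Σ_*)` of those open subsets of the spectral bundle whose part in each
spectrum is closed, ordered by inclusion; its finite meets and joins are the intersections and
unions. -/
def GammaClopen (M : VonNeumannAlgebra H) :
    Sublattice (TopologicalSpace.Opens (SpectralBundle M)) where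
  carrier := {D | ∀ A, IsClosed (fiber (D : Set (SpectralBundle M)) A)}
  supClosed' _ hD _ hE A := (hD A).union (hE A)
  infClosed' _ hD _ hE A := (hD A).inter (hE A)

/-- The empty set and the whole bundle are the least and greatest elements. -/
instance (M : VonNeumannAlgebra H) : BoundedOrder (GammaClopen M) where
  bot := ⟨⊥, fun _ => isClosed_empty⟩
  bot_le D := bot_le (a := D.1)
  top := ⟨⊤, fun _ => isClosed_univ⟩
  le_top D := le_top (a := D.1)

/-- The part of an element of `Γ Clopen(Σ_*)` in the spectrum of `A`. -/
def GammaClopen.component {M : VonNeumannAlgebra H} (D : GammaClopen M) (A : Context M) :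
    Set A.Max :=
  SpectralBundle.fiber (D.1 : Set (SpectralBundle M)) A

/-! ### Inner daseinisation -/

/-- The inner daseinisation of `p` at the context `A`: the join of the projections of `A` that
lie below `p`. -/
def innerDas {M : VonNeumannAlgebra H} (p : Projection M) (A : Context M) :
    Projection A.alg :=
  sSup {q : Projection A.alg | Projection.incl A.le q ≤ p}

theorem innerDas_mono {M : VonNeumannAlgebra H} (p : Projection M) {A B : Context M}
    (h : A ≤ B) : (innerDas p A).op * (innerDas p B).op = (innerDas p A).op := by
  have h1 : Projection.incl A.le (innerDas p A) ≤ p :=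
    Projection.le_of_forall_incl A.le fun _ hq => hq
  have h2 : Projection.incl (M := B.alg) h (innerDas p A) ≤ innerDas p B := le_sSup h1
  exact h2

/-- Inner daseinisation `p ↦ {(A, λ) | λ(δⁱ(p)_A) = 1}` as a map into `Γ Clopen(Σ_*)`. -/
def daseinisation {M : VonNeumannAlgebra H} (p : Projection M) : GammaClopen M :=
  ⟨⟨{x | Context.evalProj x.char (innerDas p x.ctx) = 1},
    fun A => (Context.isClopen_evalProj_eq_one (innerDas p A)).isOpen,
    fun A B h l hl => by
      have h1 : l ⟨(innerDas p A).op, h (innerDas p A).mem⟩ = 1 := hl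
      have h2 : (⟨(innerDas p A).op, h (innerDas p A).mem⟩ : B.alg.toStarSubalgebra) *
          ⟨(innerDas p B).op, (innerDas p B).mem⟩ =
          ⟨(innerDas p A).op, h (innerDas p A).mem⟩ := Subtype.ext (innerDas_mono p h)
      have h3 := congrArg l h2
      rw [map_mul, h1, one_mul] at h3
      exact h3⟩,
    fun A => (Context.isClopen_evalProj_eq_one (innerDas p A)).isClosed⟩

end TQL

end

noncomputable section

namespace TQL

variable {H : Type*} [NormedAddCommGroup H] [InnerProductSpace ℂ H] [CompleteSpace H]
  {M : VonNeumannAlgebra H}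

/-! By Gelfand duality the clopen subsets of a spectrum are the projections of the context, so an
element of `GammaClopen M` is a family of projections that grows with the context. It lies below
δⁱ(p) iff all these projections lie below p (`le_daseinisation_iff`). Hence δⁱ preserves meets; it
reflects the order because δⁱ(p) is p itself at the context generated by p.

The spectra are extremally disconnected: the closure of an open U is cut out by the projection onto
the closed span of the ranges of the elements supported on U (`exists_projection_closure`). So
interiors of intersections are clopen and give meets, and closures of unions give pseudocomplements;
the latter form an open subset of the bundle because restriction of characters is an open map
(`isOpenMap_restrict`).

For p ≠ 1, δⁱ(p) is empty over the scalar context, and an element that is full there is full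
everywhere. So δⁱ(p) ⊔ D = ⊤ forces D = ⊤, which is false for D = δⁱ(1 - p) and D = ¬δⁱ(p) when p ≠
0. If p and q do not commute, r = q - q ⊓ p meets p trivially without being orthogonal to it, so
δⁱ(r) lies below ¬δⁱ(p) but not below δⁱ(1 - p). Such projections exist because the projections of a
context separate its characters. -/

theorem isClosed_vonNeumannAlgebra (N : VonNeumannAlgebra H) :
    IsClosed (N : Set (H →L[ℂ] H)) := by
  rw [← N.centralizer_centralizer]
  exact Set.isClosed_centralizer _

/-! ### Gelfand duality: projections, clopen sets, extremal disconnectedness -/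

namespace Context

/-- A context as a commutative C⋆-algebra. -/
abbrev commCStarAlgebra (A : Context M) : CommCStarAlgebra A.alg.toStarSubalgebra :=
  { StarSubalgebra.cstarAlgebra A.alg.toStarSubalgebra
      (h_closed := isClosed_vonNeumannAlgebra A.alg) with
    mul_comm := fun a b => Subtype.ext (A.comm a.1 a.2 b.1 b.2) }

/-- The Gelfand isomorphism of a context. -/
def gelfand (A : Context M) : A.alg.toStarSubalgebra ≃⋆ₐ[ℂ] C(A.Max, ℂ) :=
  letI := A.commCStarAlgebra
  gelfandStarTransform A.alg.toStarSubalgebra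

theorem gelfand_apply (A : Context M) (a : A.alg.toStarSubalgebra) (l : A.Max) :
    A.gelfand a l = l a := rfl

instance (A : Context M) : CompactSpace A.Max :=
  letI := A.commCStarAlgebra
  inferInstanceAs (CompactSpace (WeakDual.characterSpace ℂ A.alg.toStarSubalgebra))

theorem ext_of_forall_char {A : Context M} {a b : A.alg.toStarSubalgebra}
    (h : ∀ l : A.Max, l a = l b) : a = b :=
  A.gelfand.injective (ContinuousMap.ext h)

end Context

/-- The projection onto the closed span of the ranges of a set of operators of `N` lies in `N`,
fixes all these operators from the left, and is annihilated by what annihilates all of them. -/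
theorem Projection.exists_range_projection (N : VonNeumannAlgebra H) (I : Set (H →L[ℂ] H))
    (hI : ∀ a ∈ I, a ∈ N) :
    ∃ p : Projection N, (∀ a ∈ I, p.op * a = a) ∧
      ∀ T : H →L[ℂ] H, (∀ a ∈ I, T * a = 0) → T * p.op = 0 := by
  set K : Submodule ℂ H := ⨆ a ∈ I, a.range with hK
  have hle : ∀ a ∈ I, a.range ≤ K := fun a ha =>
    le_iSup₂_of_le (f := fun (a : H →L[ℂ] H) (_ : a ∈ I) => a.range) a ha le_rfl
  refine ⟨⟨K.topologicalClosure.starProjection, ?_, isStarProjection_starProjection⟩, ?_, ?_⟩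
  · rw [VonNeumannAlgebra.IsStarProjection.mem_iff isStarProjection_starProjection]
    intro y hy
    rw [Submodule.range_starProjection, Module.End.mem_invtSubmodule]
    have h1 : K ≤ K.comap (y : H →ₗ[ℂ] H) := by
      refine iSup₂_le fun a ha => ?_
      rintro _ ⟨x, rfl⟩
      have h2 := VonNeumannAlgebra.mem_commutant_iff.1 hy a (hI a ha)
      have h3 : y (a x) = a (y x) := congrArg (fun T : H →L[ℂ] H => T x) h2.symm
      change y (a x) ∈ K
      rw [h3]
      exact hle a ha ⟨y x, rfl⟩
    intro x hx
    exact map_mem_closure y.continuous hx (fun a ha => h1 ha)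
  · intro a ha
    ext x
    exact Submodule.starProjection_eq_self_iff.2
      (K.le_topologicalClosure (hle a ha ⟨x, rfl⟩))
  · intro T hT
    have h1 : K.topologicalClosure ≤ T.ker := by
      refine Submodule.topologicalClosure_minimal _ (iSup₂_le fun a ha => ?_) T.isClosed_ker
      rintro _ ⟨x, rfl⟩
      exact congrArg (fun S : H →L[ℂ] H => S x) (hT a ha)
    ext x
    exact h1 (Submodule.starProjection_apply_mem _ x)

namespace Context

theorem evalProj_eq_zero_iff {A : Context M} (l : A.Max) (p : Projection A.alg) :
    evalProj l p = 0 ↔ evalProj l p ≠ 1 := by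
  rcases evalProj_eq_zero_or_one l p with h | h <;> simp [h]

/-- Characters separate the elements of A and take only the values 0 and 1 at projections, so pq = p
can be tested pointwise. -/
theorem evalProj_le_iff {A : Context M} {p q : Projection A.alg} :
    p ≤ q ↔ ∀ l : A.Max, evalProj l p = 1 → evalProj l q = 1 := by
  have h0 : p ≤ q ↔ (⟨p.op, p.mem⟩ : A.alg.toStarSubalgebra) * ⟨q.op, q.mem⟩ = ⟨p.op, p.mem⟩ :=
    (Subtype.ext_iff (a1 := (⟨p.op, p.mem⟩ : A.alg.toStarSubalgebra) * ⟨q.op, q.mem⟩)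
      (a2 := ⟨p.op, p.mem⟩)).symm
  rw [h0]
  constructor
  · intro h l hl
    have h1 := congrArg l h
    rw [map_mul] at h1
    change evalProj l p * evalProj l q = evalProj l p at h1
    rwa [hl, one_mul] at h1
  · intro h
    refine ext_of_forall_char fun l => ?_
    rw [map_mul]
    change evalProj l p * evalProj l q = evalProj l p
    rcases evalProj_eq_zero_or_one l p with h1 | h1
    · rw [h1, zero_mul]
    · rw [h l h1, mul_one]

/-- The indicator function of C is continuous, idempotent and real; its inverse Gelfand transform is
the projection. -/
theorem exists_projection_of_isClopen (A : Context M) {C : Set A.Max} (hC : IsClopen C) :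
    ∃ p : Projection A.alg, {l : A.Max | evalProj l p = 1} = C := by
  classical
  let f : C(A.Max, ℂ) :=
    ⟨C.indicator fun _ => 1, (continuous_const).indicator (by simp [hC.frontier_eq])⟩
  have hf : ∀ l, f l = if l ∈ C then 1 else 0 := fun l => by
    simp [f, Set.indicator_apply]
  have h1 : f * f = f := by
    ext l
    simp [hf]
  have h2 : star f = f := by
    ext l
    simp only [ContinuousMap.star_apply, hf]
    split_ifs <;> simp
  have h3 : A.gelfand.symm f * A.gelfand.symm f = A.gelfand.symm f := by rw [← map_mul, h1]
  have h4 : star (A.gelfand.symm f) = A.gelfand.symm f := by rw [← map_star, h2]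
  refine ⟨⟨(A.gelfand.symm f).1, (A.gelfand.symm f).2,
    ⟨congrArg Subtype.val h3, congrArg Subtype.val h4⟩⟩, ?_⟩
  ext l
  have h5 : l (A.gelfand.symm f) = f l := by
    rw [← gelfand_apply, StarAlgEquiv.apply_symm_apply]
  change l (A.gelfand.symm f) = 1 ↔ _
  rw [h5, hf]
  simp

/-- Open subsets of the spectrum have clopen closures, and the projection that represents the
closure is the range projection of the ideal of elements supported on the open set. -/
theorem exists_projection_closure (A : Context M) {U : Set A.Max} (hU : IsOpen U) :
    ∃ p : Projection A.alg, {l : A.Max | evalProj l p = 1} = closure U ∧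
      ∀ T : H →L[ℂ] H,
        (∀ a : A.alg.toStarSubalgebra, (∀ l : A.Max, l ∉ U → l a = 0) → T * a.1 = 0) →
          T * p.op = 0 := by
  obtain ⟨p, hp1, hp2⟩ := Projection.exists_range_projection A.alg
    {a | ∃ h : a ∈ A.alg.toStarSubalgebra, ∀ l : A.Max, l ∉ U → l ⟨a, h⟩ = 0}
    (fun a ha => ha.1)
  -- Urysohn's lemma, transported to A by the inverse Gelfand transform.
  have hsep : ∀ F : Set A.Max, IsClosed F → ∀ x ∉ F,
      ∃ a : A.alg.toStarSubalgebra, (∀ l ∈ F, l a = 0) ∧ x a = 1 := by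
    intro F hF x hx
    obtain ⟨f, hf0, hf1, -⟩ := exists_continuous_zero_one_of_isClosed hF isClosed_singleton
      (Set.disjoint_singleton_right.2 hx)
    let g : C(A.Max, ℂ) := ⟨fun l => (f l : ℂ), by fun_prop⟩
    have hg : ∀ l : A.Max, l (A.gelfand.symm g) = g l := fun l => by
      rw [← gelfand_apply, StarAlgEquiv.apply_symm_apply]
    refine ⟨A.gelfand.symm g, fun l hl => ?_, ?_⟩
    · rw [hg]
      simp [g, hf0 hl]
    · rw [hg]
      simp [g, hf1 (Set.mem_singleton x)]
  refine ⟨p, subset_antisymm ?_ ?_, fun T hT => hp2 T fun a ha => hT ⟨a, ha.1⟩ ha.2⟩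
  · intro l hl
    by_contra hlU
    obtain ⟨g, hg0, hg1⟩ := hsep _ isClosed_closure l hlU
    -- g vanishes on U, so it annihilates everything supported on U and hence p; but l takes the
    -- value 1 at both g and p.
    have h1 : g.1 * p.op = 0 := by
      refine hp2 g.1 ?_
      rintro a ⟨ha, ha0⟩
      have h2 : g * ⟨a, ha⟩ = 0 := by
        refine ext_of_forall_char fun l => ?_
        rw [map_mul, map_zero]
        by_cases hl : l ∈ U
        · rw [hg0 l (subset_closure hl), zero_mul]
        · rw [ha0 l hl, mul_zero]
      exact congrArg Subtype.val h2
    have h2 : g * ⟨p.op, p.mem⟩ = 0 := Subtype.ext h1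
    have h3 := congrArg l h2
    rw [map_mul, map_zero, hg1, one_mul] at h3
    exact zero_ne_one (h3.symm.trans hl)
  · refine closure_minimal ?_ (isClopen_evalProj_eq_one p).isClosed
    intro l hl
    obtain ⟨f, hf0, hf1⟩ := hsep _ hU.isClosed_compl l (fun h => h hl)
    -- f is supported on U, so p fixes it, and l(f) = 1 forces l(p) = 1.
    have h1 : (⟨p.op, p.mem⟩ : A.alg.toStarSubalgebra) * f = f :=
      Subtype.ext (hp1 f.1 ⟨f.2, hf0⟩)
    have h2 := congrArg l h1
    rw [map_mul, hf1, mul_one] at h2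
    exact h2

instance (A : Context M) : ExtremallyDisconnected A.Max where
  open_closure U hU := by
    obtain ⟨p, hp, -⟩ := A.exists_projection_closure hU
    rw [← hp]
    exact (isClopen_evalProj_eq_one p).isOpen

theorem isClosed_interior {A : Context M} {F : Set A.Max} (hF : IsClosed F) :
    IsClosed (interior F) := by
  rw [interior_eq_compl_closure_compl]
  exact (ExtremallyDisconnected.open_closure _ hF.isOpen_compl).isClosed_compl

/-! ### Restriction of characters is continuous and open -/

theorem continuous_restrict {A B : Context M} (h : A ≤ B) : Continuous (restrict h) := by
  refine Continuous.subtype_mk (WeakDual.continuous_of_continuous_eval fun a => ?_) _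
  exact (WeakDual.eval_continuous (inclCLM h a)).comp continuous_subtype_val

/-- The image K is compact, hence closed. If p in A represents the closure of Kᶜ, then q annihilates
all elements of A supported on Kᶜ, so qp = 0. Hence no character with value 1 at q restricts into
that closure, and Kᶜ is closed. -/
theorem isOpen_image_restrict {A B : Context M} (h : A ≤ B) (q : Projection B.alg) :
    IsOpen (restrict h '' {l : B.Max | evalProj l q = 1}) := by
  set K := restrict h '' {l : B.Max | evalProj l q = 1} with hK
  have hKc : IsClosed K :=
    ((isClopen_evalProj_eq_one q).isClosed.isCompact.image (continuous_restrict h)).isClosed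
  obtain ⟨p, hp, hT⟩ := A.exists_projection_closure hKc.isOpen_compl
  have h1 : q.op * p.op = 0 := by
    refine hT q.op fun a ha => ?_
    have h2 : (⟨q.op, q.mem⟩ : B.alg.toStarSubalgebra) * ⟨a.1, h a.2⟩ = 0 := by
      refine ext_of_forall_char fun l => ?_
      rw [map_mul, map_zero, ← restrict_apply h l a]
      rcases evalProj_eq_zero_or_one l q with h3 | h3
      · exact mul_eq_zero_of_left h3 _
      · rw [ha (restrict h l) (fun h4 => h4 ⟨l, h3, rfl⟩), mul_zero]
    exact congrArg Subtype.val h2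
  have h2 : closure Kᶜ ⊆ Kᶜ := by
    rintro _ hl ⟨l, hlq, rfl⟩
    rw [← hp] at hl
    have h3 : (⟨q.op, q.mem⟩ : B.alg.toStarSubalgebra) * ⟨p.op, h p.mem⟩ = 0 := Subtype.ext h1
    have h4 := congrArg l h3
    rw [map_mul, map_zero] at h4
    have h5 : l ⟨q.op, q.mem⟩ = 1 := hlq
    have h6 : l ⟨p.op, h p.mem⟩ = 1 := hl
    rw [h5, h6, one_mul] at h4
    exact one_ne_zero h4
  exact isClosed_compl_iff.1 (isClosed_of_closure_subset h2)

theorem isOpenMap_restrict {A B : Context M} (h : A ≤ B) : IsOpenMap (restrict h) := by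
  intro V hV
  rw [isOpen_iff_mem_nhds]
  rintro _ ⟨l, hl, rfl⟩
  -- Clopen sets form a basis, and each is represented by a projection.
  obtain ⟨C, hC, hlC, hCV⟩ := compact_exists_isClopen_in_isOpen hV hl
  obtain ⟨q, rfl⟩ := B.exists_projection_of_isClopen hC
  exact Filter.mem_of_superset ((isOpen_image_restrict h q).mem_nhds ⟨l, hlC, rfl⟩)
    (Set.image_mono hCV)

end Context

/-! ### Scalar and singly generated contexts; abundance of projections -/

/-- The commutant of a set of operators and their adjoints. -/
def commutantOf (s : Set (H →L[ℂ] H)) : VonNeumannAlgebra H where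
  toStarSubalgebra := StarSubalgebra.centralizer ℂ s
  centralizer_centralizer' := by
    change Set.centralizer (Set.centralizer (StarSubalgebra.centralizer ℂ s : Set (H →L[ℂ] H))) =
      (StarSubalgebra.centralizer ℂ s : Set (H →L[ℂ] H))
    rw [StarSubalgebra.coe_centralizer, Set.centralizer_centralizer_centralizer]

theorem mem_commutantOf {s : Set (H →L[ℂ] H)} {z : H →L[ℂ] H} :
    z ∈ commutantOf s ↔ ∀ g ∈ s, g * z = z * g ∧ star g * z = z * star g :=
  StarSubalgebra.mem_centralizer_iff ℂ

theorem smul_one_mem (N : VonNeumannAlgebra H) (c : ℂ) : c • (1 : H →L[ℂ] H) ∈ N := by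
  have h := algebraMap_mem N.toStarSubalgebra c
  rwa [Algebra.algebraMap_eq_smul_one] at h

omit [CompleteSpace H] in
/-- An operator that commutes with all operators is scalar. -/
theorem exists_eq_smul_one_of_commute {a : H →L[ℂ] H} (ha : ∀ b : H →L[ℂ] H, b * a = a * b) :
    ∃ c : ℂ, a = c • (1 : H →L[ℂ] H) := by
  rcases subsingleton_or_nontrivial H with hH | hH
  · exact ⟨0, ContinuousLinearMap.ext fun x => Subsingleton.elim _ _⟩
  · obtain ⟨x, hx⟩ := exists_ne (0 : H)
    have hx' : inner ℂ x x ≠ (0 : ℂ) := inner_self_ne_zero.2 hx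
    refine ⟨inner ℂ x (a x) / inner ℂ x x, ContinuousLinearMap.ext fun z => ?_⟩
    -- Commutation with the rank-one operator v ↦ ⟨x, v⟩ z, evaluated at x.
    have h1 : (inner ℂ x (a x) : ℂ) • z = a ((inner ℂ x x : ℂ) • z) :=
      congrArg (fun T : H →L[ℂ] H => T x) (ha ((innerSL ℂ x).smulRight z))
    rw [map_smul] at h1
    change a z = (inner ℂ x (a x) / inner ℂ x x : ℂ) • z
    rw [div_eq_inv_mul, mul_smul, h1, inv_smul_smul₀ hx']

namespace Context

/-- The context of the scalar operators. -/
def scalar (M : VonNeumannAlgebra H) : Context M where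
  alg := commutantOf Set.univ
  le a ha := by
    obtain ⟨c, rfl⟩ := exists_eq_smul_one_of_commute
      fun b => (mem_commutantOf.1 ha b (Set.mem_univ b)).1
    exact smul_one_mem M c
  comm a _ b hb := (mem_commutantOf.1 hb a (Set.mem_univ a)).1

theorem exists_eq_smul_one_of_mem_scalar {a : H →L[ℂ] H} (ha : a ∈ (scalar M).alg) :
    ∃ c : ℂ, a = c • (1 : H →L[ℂ] H) :=
  exists_eq_smul_one_of_commute fun b => (mem_commutantOf.1 ha b (Set.mem_univ b)).1

theorem scalar_le (A : Context M) : scalar M ≤ A := by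
  intro a ha
  obtain ⟨c, rfl⟩ := exists_eq_smul_one_of_mem_scalar ha
  exact smul_one_mem A.alg c

/-- The context generated by a self-adjoint element. -/
def generate (a : H →L[ℂ] H) (ha : a ∈ M) (hsa : IsSelfAdjoint a) : Context M where
  alg := commutantOf (commutantOf {a} : Set (H →L[ℂ] H))
  le b hb := by
    rw [← SetLike.mem_coe, ← M.centralizer_centralizer]
    intro c hc
    have h1 : c ∈ commutantOf {a} := by
      refine mem_commutantOf.2 ?_
      rintro _ rfl
      rw [hsa.star_eq]
      exact ⟨hc _ ha, hc _ ha⟩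
    exact (mem_commutantOf.1 hb c h1).1
  comm b hb c hc := by
    -- Since a commutes with itself, {a}'' ⊆ {a}', which makes {a}'' commutative.
    have h1 : ∀ d ∈ commutantOf (commutantOf {a} : Set (H →L[ℂ] H)), d ∈ commutantOf {a} := by
      intro d hd
      refine mem_commutantOf.2 ?_
      intro g hg
      rw [Set.mem_singleton_iff.1 hg, hsa.star_eq]
      have h2 : a ∈ commutantOf {a} := by
        refine mem_commutantOf.2 ?_
        intro g hg
        rw [Set.mem_singleton_iff.1 hg, hsa.star_eq]
        exact ⟨rfl, rfl⟩
      exact ⟨(mem_commutantOf.1 hd a h2).1, (mem_commutantOf.1 hd a h2).1⟩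
    exact (mem_commutantOf.1 hc b (h1 b hb)).1

theorem mem_generate (a : H →L[ℂ] H) (ha : a ∈ M) (hsa : IsSelfAdjoint a) :
    a ∈ (generate a ha hsa).alg := by
  refine mem_commutantOf.2 fun g hg => ?_
  have h1 := mem_commutantOf.1 hg a rfl
  refine ⟨h1.1.symm, ?_⟩
  have h2 := congrArg star h1.1
  rw [star_mul, star_mul, hsa.star_eq] at h2
  exact h2

theorem isometry_gelfand (A : Context M) : Isometry A.gelfand :=
  letI := A.commCStarAlgebra
  gelfandTransform_isometry A.alg.toStarSubalgebra

theorem exists_projection_separating {A : Context M} {l m : A.Max} (h : l ≠ m) :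
    ∃ p : Projection A.alg, evalProj l p = 1 ∧ evalProj m p = 0 := by
  obtain ⟨C, hC, hl, hm⟩ := exists_isClopen_of_totally_separated h
  obtain ⟨p, rfl⟩ := A.exists_projection_of_isClopen hC
  exact ⟨p, hl, (evalProj_eq_zero_iff m p).2 hm⟩

/-- An operator that commutes with the projections of a context commutes with the context. -/
theorem commute_of_forall_projection (A : Context M) {T : H →L[ℂ] H}
    (hT : ∀ p : Projection A.alg, p.op * T = T * p.op) {a : H →L[ℂ] H} (ha : a ∈ A.alg) :
    a * T = T * a := by
  let φ : C(A.Max, ℂ) →⋆ₐ[ℂ] (H →L[ℂ] H) :=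
    A.alg.toStarSubalgebra.subtype.comp (A.gelfand.symm : C(A.Max, ℂ) →⋆ₐ[ℂ] _)
  have hφ : Continuous φ :=
    continuous_subtype_val.comp
      (A.isometry_gelfand.right_inv A.gelfand.apply_symm_apply).continuous
  have hφa : ∀ a : A.alg.toStarSubalgebra, φ (A.gelfand a) = a := fun a =>
    congrArg Subtype.val (A.gelfand.symm_apply_apply a)
  -- Functions whose operators commute with T and its adjoint. This subalgebra is closed and
  -- contains the transforms of projections, which separate characters, so Stone–Weierstrass makes
  -- it everything.
  let S : StarSubalgebra ℂ C(A.Max, ℂ) := (StarSubalgebra.centralizer ℂ {T}).comap φ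
  have hS : ∀ f, f ∈ S ↔ φ f ∈ StarSubalgebra.centralizer ℂ {T} := fun f => Iff.rfl
  have hclosed : IsClosed (S : Set C(A.Max, ℂ)) := by
    have h1 : IsClosed (StarSubalgebra.centralizer ℂ {T} : Set (H →L[ℂ] H)) := by
      rw [StarSubalgebra.coe_centralizer]
      exact Set.isClosed_centralizer _
    exact h1.preimage hφ
  have hsep : S.SeparatesPoints := by
    intro l m hlm
    obtain ⟨p, hl, hm⟩ := exists_projection_separating hlm
    refine ⟨A.gelfand ⟨p.op, p.mem⟩, ⟨_, ?_, rfl⟩, ?_⟩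
    · refine (hS _).2 ?_
      rw [hφa, StarSubalgebra.mem_centralizer_iff]
      rintro _ rfl
      have h1 := congrArg star (hT p)
      rw [star_mul, star_mul, p.isStarProjection.isSelfAdjoint.star_eq] at h1
      exact ⟨(hT p).symm, h1⟩
    · rw [gelfand_apply, gelfand_apply]
      change evalProj l p ≠ evalProj m p
      rw [hl, hm]
      exact one_ne_zero
  have htop := ContinuousMap.starSubalgebra_topologicalClosure_eq_top_of_separatesPoints S hsep
  have h1 : A.gelfand ⟨a, ha⟩ ∈ S := by
    have h2 : A.gelfand ⟨a, ha⟩ ∈ S.topologicalClosure := htop ▸ StarSubalgebra.mem_top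
    exact StarSubalgebra.topologicalClosure_minimal le_rfl hclosed h2
  rw [hS, hφa, StarSubalgebra.mem_centralizer_iff] at h1
  exact (h1 T rfl).1.symm

/-- Trivial projections cannot separate two characters, so the spectrum has at most one point and an
element is determined by its value there. -/
theorem exists_eq_smul_one_of_forall_projection (A : Context M)
    (hA : ∀ p : Projection A.alg, p = ⊥ ∨ p = ⊤) {a : H →L[ℂ] H} (ha : a ∈ A.alg) :
    ∃ c : ℂ, a = c • (1 : H →L[ℂ] H) := by
  rcases isEmpty_or_nonempty A.Max with h | ⟨⟨m⟩⟩
  · refine ⟨0, ?_⟩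
    have h1 : (⟨a, ha⟩ : A.alg.toStarSubalgebra) = (0 : ℂ) • 1 :=
      ext_of_forall_char fun l => h.elim l
    exact congrArg Subtype.val h1
  · refine ⟨m ⟨a, ha⟩, ?_⟩
    have h1 : (⟨a, ha⟩ : A.alg.toStarSubalgebra) = m ⟨a, ha⟩ • 1 := by
      refine ext_of_forall_char fun l => ?_
      have hlm : l = m := by
        by_contra hlm
        obtain ⟨p, hl, hm⟩ := exists_projection_separating hlm
        rcases hA p with rfl | rfl
        · exact zero_ne_one ((map_zero l).symm.trans hl)
        · exact one_ne_zero ((map_one m).symm.trans hm)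
      rw [hlm, map_smul, map_one, smul_eq_mul, mul_one]
    exact congrArg Subtype.val h1

end Context

/-- A property of operators holds on `M` if it holds for the self-adjoint elements and is
inherited by sums and scalar multiples. -/
theorem induction_isSelfAdjoint {P : (H →L[ℂ] H) → Prop}
    (hsa : ∀ a ∈ M, IsSelfAdjoint a → P a) (hadd : ∀ a b, P a → P b → P (a + b))
    (hsmul : ∀ (c : ℂ) a, P a → P (c • a)) {a : H →L[ℂ] H} (ha : a ∈ M) : P a := by
  have hs : ∀ (c : ℂ) (b : H →L[ℂ] H), b ∈ M → c • b ∈ M := fun c b hb =>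
    M.toStarSubalgebra.smul_mem hb c
  have h1 : P (a + star a) := hsa _ (add_mem ha (star_mem ha)) (IsSelfAdjoint.add_star_self a)
  have h2 : P (Complex.I • (a - star a)) := by
    refine hsa _ (hs _ _ (sub_mem ha (star_mem ha))) ?_
    rw [IsSelfAdjoint, star_smul, star_sub, star_star]
    simp only [Complex.star_def, Complex.conj_I, neg_smul, ← smul_neg, neg_sub]
  -- Real and imaginary parts of a, up to scalars.
  have h3 : a = (2⁻¹ : ℂ) • (a + star a) +
      (-(2⁻¹ * Complex.I)) • (Complex.I • (a - star a)) := by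
    rw [smul_smul, neg_mul, mul_assoc, Complex.I_mul_I]
    simp only [mul_neg, mul_one, neg_neg]
    rw [← smul_add, add_add_sub_cancel, ← two_smul ℂ a, smul_smul]
    norm_num
  rw [h3]
  exact hadd _ _ (hsmul _ _ h1) (hsmul _ _ h2)

/-- A von Neumann algebra with only the trivial projections consists of scalars. -/
theorem exists_nontrivial_projection (hM : ∃ a ∈ M, ∀ c : ℂ, a ≠ c • (1 : H →L[ℂ] H)) :
    ∃ p : Projection M, p ≠ ⊥ ∧ p ≠ ⊤ := by
  by_contra! hp
  obtain ⟨a, ha, hac⟩ := hM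
  have h : ∃ c : ℂ, a = c • (1 : H →L[ℂ] H) := by
    refine induction_isSelfAdjoint (M := M) (P := fun a => ∃ c : ℂ, a = c • (1 : H →L[ℂ] H))
      ?_ ?_ ?_ ha
    · intro a ha hsa
      refine (Context.generate a ha hsa).exists_eq_smul_one_of_forall_projection (fun p => ?_)
        (Context.mem_generate a ha hsa)
      rw [or_iff_not_imp_left]
      intro h0
      have h1 := hp (Projection.incl (Context.generate a ha hsa).le p)
        fun h => h0 (Projection.ext (congrArg (Projection.op (M := M)) h))
      exact Projection.ext (congrArg (Projection.op (M := M)) h1)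
    · rintro _ _ ⟨c, rfl⟩ ⟨d, rfl⟩
      exact ⟨c + d, (add_smul _ _ _).symm⟩
    · rintro c _ ⟨d, rfl⟩
      exact ⟨c * d, (mul_smul _ _ _).symm⟩
  exact hac _ h.choose_spec

/-- An operator that commutes with the projections of `M` commutes with `M`. -/
theorem commute_of_forall_projection {T : H →L[ℂ] H}
    (hT : ∀ p : Projection M, p.op * T = T * p.op) {a : H →L[ℂ] H} (ha : a ∈ M) :
    a * T = T * a := by
  refine induction_isSelfAdjoint (M := M) (P := fun a => a * T = T * a) ?_ ?_ ?_ ha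
  · intro a ha hsa
    exact (Context.generate a ha hsa).commute_of_forall_projection
      (fun p => hT (Projection.incl (Context.generate a ha hsa).le p))
      (Context.mem_generate a ha hsa)
  · intro a b h1 h2
    rw [add_mul, mul_add, h1, h2]
  · intro c a h
    rw [smul_mul_assoc, mul_smul_comm, h]

/-- If projections commute with each other, they commute with every b in M; then b commutes with
every a in M. -/
theorem exists_noncommuting_projections (hM : ∃ a ∈ M, ∃ b ∈ M, a * b ≠ b * a) :
    ∃ p q : Projection M, p.op * q.op ≠ q.op * p.op := by
  by_contra! h
  obtain ⟨a, ha, b, hb, hab⟩ := hM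
  exact hab (commute_of_forall_projection
    (fun p => (commute_of_forall_projection (fun q => h q p) hb).symm) ha)

/-! ### Meets, distributivity and pseudocomplements in `GammaClopen M` -/

open Context
open GammaClopen (component)

namespace GammaClopen

theorem le_iff {D E : GammaClopen M} :
    D ≤ E ↔ ∀ A : Context M, component D A ⊆ component E A :=
  ⟨fun h _ _ hl => h hl, fun h x hx => h x.ctx hx⟩

theorem isClopen_component (D : GammaClopen M) (A : Context M) : IsClopen (component D A) :=
  ⟨D.2 A, D.1.2.1 A⟩

theorem preimage_component_subset (D : GammaClopen M) {A B : Context M} (h : A ≤ B) :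
    restrict h ⁻¹' component D A ⊆ component D B :=
  fun l hl => D.1.2.2 A B h l hl

/-- A family of clopen sets, compatible with restriction, as an element of `GammaClopen M`. -/
def ofComponents (F : ∀ A : Context M, Set A.Max) (hF : ∀ A, IsClopen (F A))
    (hres : ∀ (A B : Context M) (h : A ≤ B), restrict h ⁻¹' F A ⊆ F B) : GammaClopen M :=
  ⟨⟨{x | x.char ∈ F x.ctx}, fun A => (hF A).isOpen, fun A B h _ hl => hres A B h hl⟩,
    fun A => (hF A).isClosed⟩

/-- The infimum of a set: fibrewise the interior of the intersection. -/
def inf (S : Set (GammaClopen M)) : GammaClopen M :=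
  ofComponents (fun A => interior (⋂ D ∈ S, component D A))
    (fun A => ⟨isClosed_interior (isClosed_biInter fun D _ => (isClopen_component D A).isClosed),
      isOpen_interior⟩)
    fun A B h => by
      refine interior_maximal ?_ (isOpen_interior.preimage (continuous_restrict h))
      intro l hl
      refine Set.mem_iInter₂.2 fun D hD => ?_
      exact preimage_component_subset D h (Set.mem_iInter₂.1 (interior_subset hl) D hD)

theorem component_inf_set (S : Set (GammaClopen M)) (A : Context M) :
    component (inf S) A = interior (⋂ D ∈ S, component D A) := rfl

theorem isGLB_inf (S : Set (GammaClopen M)) : IsGLB S (inf S) := by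
  constructor
  · intro D hD
    exact le_iff.2 fun A l hl => Set.mem_iInter₂.1 (interior_subset hl) D hD
  · intro E hE
    refine le_iff.2 fun A => ?_
    rw [component_inf_set]
    refine interior_maximal ?_ (isClopen_component E A).isOpen
    exact Set.subset_iInter₂ fun D hD => le_iff.1 (hE hD) A

theorem component_sup (D E : GammaClopen M) (A : Context M) :
    component (D ⊔ E) A = component D A ∪ component E A := rfl

/-- For a lower bound G of all D ⊔ F, the fibrewise difference of G and D is open and contained in
every F, hence in the interior that defines the meet. -/
theorem isGLB_image_sup (D : GammaClopen M) {S : Set (GammaClopen M)} {E : GammaClopen M}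
    (hE : IsGLB S E) : IsGLB ((fun F => D ⊔ F) '' S) (D ⊔ E) := by
  obtain rfl := hE.unique (isGLB_inf S)
  constructor
  · rintro _ ⟨F, hF, rfl⟩
    exact sup_le_sup_left (hE.1 hF) D
  · intro G hG
    refine le_iff.2 fun A => ?_
    have h1 : component G A \ component D A ⊆ component (inf S) A := by
      rw [component_inf_set]
      refine interior_maximal (Set.subset_iInter₂ fun F hF => ?_)
        ((isClopen_component G A).diff (isClopen_component D A)).isOpen
      exact Set.sdiff_subset_iff.2 (le_iff.1 (hG ⟨F, hF, rfl⟩) A)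
    exact Set.sdiff_subset_iff.1 h1

/-- The pseudocomplement: fibrewise the closure of the union of all elements disjoint
from the given one. -/
def neg (D : GammaClopen M) : GammaClopen M :=
  ofComponents (fun A => closure (⋃ E ∈ {E : GammaClopen M | E ⊓ D = ⊥}, component E A))
    (fun A => ⟨isClosed_closure, ExtremallyDisconnected.open_closure _
      (isOpen_biUnion fun E _ => (isClopen_component E A).isOpen)⟩)
    fun A B h => by
      -- Openness of restriction is essential here: continuity alone gives only the inclusion of the
      -- closure of the preimage in the preimage of the closure.
      rw [(isOpenMap_restrict h).preimage_closure_eq_closure_preimage (continuous_restrict h)]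
      refine closure_mono ?_
      rw [Set.preimage_iUnion₂]
      exact Set.iUnion₂_mono fun E _ => preimage_component_subset E h

theorem component_neg (D : GammaClopen M) (A : Context M) :
    component (neg D) A =
      closure (⋃ E ∈ {E : GammaClopen M | E ⊓ D = ⊥}, component E A) := rfl

theorem inf_eq_bot_iff {D E : GammaClopen M} :
    E ⊓ D = ⊥ ↔ ∀ A : Context M, Disjoint (component E A) (component D A) := by
  rw [← le_bot_iff, le_iff]
  exact forall_congr' fun A => Set.disjoint_iff.symm

theorem le_neg_iff (D E : GammaClopen M) : E ≤ neg D ↔ E ⊓ D = ⊥ := by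
  constructor
  · intro h
    rw [inf_eq_bot_iff]
    intro A
    refine Disjoint.mono_left (le_iff.1 h A) ?_
    rw [component_neg]
    refine Disjoint.closure_left ?_ (isClopen_component D A).isOpen
    exact Set.disjoint_iUnion₂_left.2 fun F hF => inf_eq_bot_iff.1 hF A
  · intro h
    refine le_iff.2 fun A => ?_
    rw [component_neg]
    refine Set.Subset.trans ?_ subset_closure
    exact Set.subset_biUnion_of_mem (u := fun E : GammaClopen M => component E A) h

end GammaClopen

/-! ### Inner daseinisation as a meet-preserving order embedding -/

theorem component_daseinisation (p : Projection M) (A : Context M) :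
    component (daseinisation p) A = {l : A.Max | evalProj l (innerDas p A) = 1} := rfl

/-- Adjunction with the inclusion of projections: the join of the projections of A below p is still
below p. -/
theorem le_innerDas_iff {p : Projection M} {A : Context M} {q : Projection A.alg} :
    q ≤ innerDas p A ↔ Projection.incl A.le q ≤ p := by
  constructor
  · intro h
    have h1 : Projection.incl A.le (innerDas p A) ≤ p :=
      Projection.le_of_forall_incl A.le fun _ hq => hq
    have h2 : Projection.incl A.le q ≤ Projection.incl A.le (innerDas p A) := h
    exact h2.trans h1
  · exact fun h => le_sSup (a := q) h

theorem innerDas_incl {A : Context M} (p : Projection A.alg) :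
    innerDas (Projection.incl A.le p) A = p :=
  le_antisymm (Projection.le_of_forall_incl (M := A.alg) le_rfl fun _ hq => hq)
    (le_innerDas_iff.2 le_rfl)

/-- Elements of `GammaClopen M` below a daseinisation are those all of whose components
are represented by projections below the given one. -/
theorem le_daseinisation_iff {D : GammaClopen M} {p : Projection M} :
    D ≤ daseinisation p ↔ ∀ (A : Context M) (q : Projection A.alg),
      {l : A.Max | evalProj l q = 1} = component D A → Projection.incl A.le q ≤ p := by
  rw [GammaClopen.le_iff]
  constructor
  · intro h A q hq
    rw [← le_innerDas_iff, evalProj_le_iff]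
    exact fun l hl => h A (hq ▸ hl)
  · intro h A
    obtain ⟨q, hq⟩ := A.exists_projection_of_isClopen (GammaClopen.isClopen_component D A)
    have h1 := evalProj_le_iff.1 (le_innerDas_iff.2 (h A q hq))
    rw [← hq]
    exact h1

theorem daseinisation_mono : Monotone (daseinisation (M := M)) := by
  intro p q h
  refine GammaClopen.le_iff.2 fun A => ?_
  rw [component_daseinisation, component_daseinisation]
  refine evalProj_le_iff.1 ?_
  exact le_innerDas_iff.2 ((le_innerDas_iff.1 le_rfl).trans h)

theorem daseinisation_le_iff (p q : Projection M) :
    daseinisation p ≤ daseinisation q ↔ p ≤ q := by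
  refine ⟨fun h => ?_, fun h => daseinisation_mono h⟩
  -- At a context that contains p nothing is lost: the approximation of p is p.
  let A := generate p.op p.mem p.isStarProjection.isSelfAdjoint
  let r : Projection A.alg := ⟨p.op, mem_generate _ _ _, p.isStarProjection⟩
  refine le_daseinisation_iff.1 h A r ?_
  rw [component_daseinisation]
  change _ = {l : A.Max | evalProj l (innerDas (Projection.incl A.le r) A) = 1}
  rw [innerDas_incl]

theorem daseinisation_injective : Function.Injective (daseinisation (M := M)) := fun p q h =>
  le_antisymm ((daseinisation_le_iff p q).1 h.le) ((daseinisation_le_iff q p).1 h.ge)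

theorem daseinisation_bot : daseinisation (⊥ : Projection M) = ⊥ := by
  refine le_bot_iff.1 (GammaClopen.le_iff.2 fun A l hl => ?_)
  have h1 : innerDas (⊥ : Projection M) A = ⊥ := innerDas_incl (⊥ : Projection A.alg)
  rw [component_daseinisation, h1] at hl
  exact zero_ne_one ((map_zero l).symm.trans hl)

theorem daseinisation_top : daseinisation (⊤ : Projection M) = ⊤ := by
  refine top_le_iff.1 (GammaClopen.le_iff.2 fun A l _ => ?_)
  have h1 : innerDas (⊤ : Projection M) A = ⊤ := innerDas_incl (⊤ : Projection A.alg)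
  rw [component_daseinisation, h1]
  exact map_one l

theorem isGLB_daseinisation (S : Set (Projection M)) :
    IsGLB (daseinisation '' S) (daseinisation (sInf S)) := by
  constructor
  · rintro _ ⟨p, hp, rfl⟩
    exact daseinisation_mono (sInf_le hp)
  · intro D hD
    exact le_daseinisation_iff.2 fun A q hq =>
      le_sInf fun p hp => le_daseinisation_iff.1 (hD ⟨p, hp, rfl⟩) A q hq

theorem daseinisation_inf (p q : Projection M) :
    daseinisation (p ⊓ q) = daseinisation p ⊓ daseinisation q := by
  have h := isGLB_daseinisation {p, q}
  rw [Set.image_pair, sInf_pair] at h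
  exact h.unique isGLB_pair

/-! ### The scalar context: failure of joins and of the excluded middle -/

theorem Context.eq_bot_or_eq_top_of_scalar (p : Projection (scalar M).alg) : p = ⊥ ∨ p = ⊤ := by
  obtain ⟨c, hc⟩ := exists_eq_smul_one_of_mem_scalar p.mem
  rcases subsingleton_or_nontrivial H with hH | hH
  · exact Or.inl (Projection.ext (ContinuousLinearMap.ext fun x => Subsingleton.elim _ _))
  have h1 := p.isStarProjection.isIdempotentElem.eq
  rw [hc, smul_mul_smul_comm, one_mul] at h1
  have h2 : c * c = c := smul_left_injective ℂ one_ne_zero h1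
  rcases eq_or_ne c 0 with rfl | h0
  · exact Or.inl (Projection.ext (hc.trans (zero_smul _ _)))
  · have h3 : c = 1 := mul_left_cancel₀ h0 (h2.trans (mul_one c).symm)
    exact Or.inr (Projection.ext (hc.trans (by rw [h3, one_smul]; rfl)))

theorem innerDas_scalar {p : Projection M} (hp : p ≠ ⊤) : innerDas p (scalar M) = ⊥ := by
  refine (eq_bot_or_eq_top_of_scalar _).resolve_right fun h => hp (top_le_iff.1 ?_)
  exact le_innerDas_iff.1 h.ge

theorem component_daseinisation_scalar {p : Projection M} (hp : p ≠ ⊤) :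
    component (daseinisation p) (scalar M) = ∅ := by
  rw [component_daseinisation p, innerDas_scalar hp]
  refine Set.eq_empty_of_forall_notMem fun l hl => ?_
  exact zero_ne_one ((map_zero l).symm.trans hl)

/-- An element that together with the daseinisation of a proper projection covers the bundle is
the whole bundle. -/
theorem eq_top_of_daseinisation_sup_eq_top {p : Projection M} (hp : p ≠ ⊤) {D : GammaClopen M}
    (h : daseinisation p ⊔ D = ⊤) : D = ⊤ := by
  refine top_le_iff.1 (GammaClopen.le_iff.2 fun A l _ => ?_)
  -- Over the scalar context only D can contain the restriction of l, and openness of D carries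
  -- membership back up to l.
  have h1 : restrict (scalar_le A) l ∈ component (daseinisation p ⊔ D) (scalar M) := by
    rw [h]
    trivial
  rw [GammaClopen.component_sup, component_daseinisation_scalar hp, Set.empty_union] at h1
  exact GammaClopen.preimage_component_subset D (scalar_le A) h1

theorem Projection.sup_ortho (p : Projection M) : p ⊔ p.ortho = ⊤ := by
  refine top_le_iff.1 ?_
  have h1 : p.op * (p ⊔ p.ortho).op = p.op := le_sup_left (a := p) (b := p.ortho)
  have h2 : (1 - p.op) * (p ⊔ p.ortho).op = 1 - p.op := le_sup_right (a := p) (b := p.ortho)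
  have h3 : (1 : H →L[ℂ] H) * (p ⊔ p.ortho).op = 1 := by
    rw [sub_mul, h1] at h2
    exact sub_left_injective h2
  exact h3

theorem Projection.ortho_ne_top {p : Projection M} (hp : p ≠ ⊥) : p.ortho ≠ ⊤ := by
  intro h
  have h1 : 1 - p.op = 1 := congrArg Projection.op h
  exact hp (Projection.ext (sub_eq_self.1 h1))

theorem daseinisation_sup_ortho_ne {p : Projection M} (h0 : p ≠ ⊥) (h1 : p ≠ ⊤) :
    daseinisation (p ⊔ p.ortho) ≠ daseinisation p ⊔ daseinisation p.ortho := by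
  intro h
  rw [p.sup_ortho, daseinisation_top] at h
  have h2 := eq_top_of_daseinisation_sup_eq_top h1 h.symm
  rw [← daseinisation_top] at h2
  exact Projection.ortho_ne_top h0 (daseinisation_injective h2)

theorem daseinisation_sup_neg_ne_top {p : Projection M} (h0 : p ≠ ⊥) (h1 : p ≠ ⊤) :
    daseinisation p ⊔ GammaClopen.neg (daseinisation p) ≠ ⊤ := by
  intro h
  have h2 := (GammaClopen.le_neg_iff _ _).1 (eq_top_of_daseinisation_sup_eq_top h1 h).ge
  rw [top_inf_eq, ← daseinisation_bot] at h2
  exact h0 (daseinisation_injective h2)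

/-! ### Noncommuting projections: failure of negation -/

theorem Projection.le_ortho_iff {p q : Projection M} : q ≤ p.ortho ↔ q.op * p.op = 0 := by
  rw [Projection.le_def]
  change q.op * (1 - p.op) = q.op ↔ _
  rw [mul_sub, mul_one, sub_eq_self]

/-- If two projections do not commute, some projection meets the first one trivially without
being orthogonal to it. -/
theorem Projection.exists_inf_eq_bot_not_le_ortho {p q : Projection M}
    (h : p.op * q.op ≠ q.op * p.op) : ∃ r : Projection M, r ⊓ p = ⊥ ∧ ¬ r ≤ p.ortho := by
  set m := q ⊓ p with hm
  have hmq : m ≤ q := inf_le_left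
  have hmp : m ≤ p := inf_le_right
  let r : Projection M := ⟨q.op - m.op, sub_mem q.mem m.mem,
    m.isStarProjection.sub_of_mul_eq_left q.isStarProjection (le_def.1 hmq)⟩
  have hrq : r ≤ q := by
    rw [le_def]
    change (q.op - m.op) * q.op = q.op - m.op
    rw [sub_mul, q.isStarProjection.isIdempotentElem.eq, le_def.1 hmq]
  have hrm : r.op * m.op = 0 := by
    change (q.op - m.op) * m.op = 0
    rw [sub_mul, mul_eq_of_le hmq, m.isStarProjection.isIdempotentElem.eq, sub_self]
  refine ⟨r, ?_, fun hr => h ?_⟩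
  · have h1 : r ⊓ p ≤ r := inf_le_left
    have h2 : r ⊓ p ≤ m := le_inf (inf_le_left.trans hrq) inf_le_right
    refine Projection.ext ?_
    rw [← le_def.1 h2, ← le_def.1 h1, mul_assoc, hrm, mul_zero]
    rfl
  -- Orthogonality of r and p gives qp = m, which is self-adjoint, so p and q would commute.
  · have h1 : (q.op - m.op) * p.op = 0 := le_ortho_iff.1 hr
    rw [sub_mul, le_def.1 hmp, sub_eq_zero] at h1
    have h2 := congrArg star h1
    rw [star_mul, p.isStarProjection.isSelfAdjoint.star_eq,
      q.isStarProjection.isSelfAdjoint.star_eq, m.isStarProjection.isSelfAdjoint.star_eq] at h2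
    rw [h1, h2]

theorem exists_daseinisation_ortho_ne_neg (hM : ∃ a ∈ M, ∃ b ∈ M, a * b ≠ b * a) :
    ∃ p : Projection M, daseinisation p.ortho ≠ GammaClopen.neg (daseinisation p) := by
  obtain ⟨p, q, hpq⟩ := exists_noncommuting_projections hM
  obtain ⟨r, hrp, hr⟩ := Projection.exists_inf_eq_bot_not_le_ortho hpq
  refine ⟨p, fun h => hr ?_⟩
  rw [← daseinisation_le_iff, h, GammaClopen.le_neg_iff, ← daseinisation_inf, hrp,
    daseinisation_bot]

/-! ### The isomorphism at a single context, and the theorem -/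

/-- Inner daseinisation at a context, as an order isomorphism from the projections of the
context to the clopen subsets of its spectrum. -/
theorem exists_orderIso_clopens (A : Context M) :
    ∃ e : Projection A.alg ≃o TopologicalSpace.Clopens A.Max,
      ∀ p : Projection A.alg, (e p : Set A.Max) =
        component (daseinisation (Projection.incl A.le p)) A := by
  let f : Projection A.alg → TopologicalSpace.Clopens A.Max := fun p =>
    ⟨{l : A.Max | evalProj l p = 1}, isClopen_evalProj_eq_one p⟩
  have hf : ∀ p q, f p ≤ f q ↔ p ≤ q := fun p q => evalProj_le_iff.symm
  let g : Projection A.alg ↪o TopologicalSpace.Clopens A.Max := OrderEmbedding.ofMapLEIff f hf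
  have hg : Function.Surjective g := by
    rintro ⟨C, hC⟩
    obtain ⟨p, rfl⟩ := A.exists_projection_of_isClopen hC
    exact ⟨p, rfl⟩
  refine ⟨RelIso.ofSurjective g hg, fun p => ?_⟩
  rw [component_daseinisation, innerDas_incl]
  rfl

end TQL

end

theorem mainTheorem2 {H : Type*} [NormedAddCommGroup H] [InnerProductSpace ℂ H]
    [CompleteSpace H] (M : VonNeumannAlgebra H) :
    -- inner daseinisation is injective and an order embedding
    Function.Injective (TQL.daseinisation (M := M)) ∧
    (∀ p q : TQL.Projection M, TQL.daseinisation p ≤ TQL.daseinisation q ↔ p ≤ q) ∧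
    -- it preserves 0, 1, binary meets and arbitrary meets
    TQL.daseinisation (⊥ : TQL.Projection M) = ⊥ ∧
    TQL.daseinisation (⊤ : TQL.Projection M) = ⊤ ∧
    (∀ p q : TQL.Projection M,
      TQL.daseinisation (p ⊓ q) = TQL.daseinisation p ⊓ TQL.daseinisation q) ∧
    (∀ S : Set (TQL.Projection M),
      IsGLB (TQL.daseinisation '' S) (TQL.daseinisation (sInf S))) ∧
    -- the target has all small meets, and is distributive, also over small meets
    (∀ S : Set (TQL.GammaClopen M), ∃ E, IsGLB S E) ∧
    (∀ D E F : TQL.GammaClopen M, D ⊓ (E ⊔ F) = (D ⊓ E) ⊔ (D ⊓ F)) ∧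
    (∀ (D : TQL.GammaClopen M) (S : Set (TQL.GammaClopen M)) (E : TQL.GammaClopen M),
      IsGLB S E → IsGLB ((fun F => D ⊔ F) '' S) (D ⊔ E)) ∧
    -- joins: an inequality, which is not an equality in general
    (∀ p q : TQL.Projection M,
      TQL.daseinisation p ⊔ TQL.daseinisation q ≤ TQL.daseinisation (p ⊔ q)) ∧
    ((∃ a ∈ M, ∀ c : ℂ, a ≠ c • (1 : H →L[ℂ] H)) →
      ∃ p q : TQL.Projection M,
        TQL.daseinisation (p ⊔ q) ≠ TQL.daseinisation p ⊔ TQL.daseinisation q) ∧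
    -- the negation (pseudocomplement) of the target: not preserved, no excluded middle
    (∃ neg : TQL.GammaClopen M → TQL.GammaClopen M,
      (∀ D E : TQL.GammaClopen M, E ≤ neg D ↔ E ⊓ D = ⊥) ∧
      ((∃ a ∈ M, ∃ b ∈ M, a * b ≠ b * a) →
        ∃ p : TQL.Projection M, TQL.daseinisation p.ortho ≠ neg (TQL.daseinisation p)) ∧
      ((∃ a ∈ M, ∀ c : ℂ, a ≠ c • (1 : H →L[ℂ] H)) →
        ∃ D : TQL.GammaClopen M, D ⊔ neg D ≠ ⊤)) ∧
    -- at each context it restricts to an order isomorphism onto the clopen sets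
    (∀ A : TQL.Context M,
      ∃ e : TQL.Projection A.alg ≃o TopologicalSpace.Clopens A.Max,
        ∀ p : TQL.Projection A.alg,
          (e p : Set A.Max) =
            TQL.GammaClopen.component (TQL.daseinisation (TQL.Projection.incl A.le p)) A) := by
  exact ⟨TQL.daseinisation_injective, TQL.daseinisation_le_iff, TQL.daseinisation_bot,
    TQL.daseinisation_top, TQL.daseinisation_inf, TQL.isGLB_daseinisation,
    fun S => ⟨_, TQL.GammaClopen.isGLB_inf S⟩, fun D E F => inf_sup_left D E F,
    fun D _ _ hE => TQL.GammaClopen.isGLB_image_sup D hE,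
    fun p q => sup_le (TQL.daseinisation_mono le_sup_left) (TQL.daseinisation_mono le_sup_right),
    fun hM =>
      let ⟨p, h0, h1⟩ := TQL.exists_nontrivial_projection hM
      ⟨p, p.ortho, TQL.daseinisation_sup_ortho_ne h0 h1⟩,
    ⟨TQL.GammaClopen.neg, TQL.GammaClopen.le_neg_iff, TQL.exists_daseinisation_ortho_ne_neg,
      fun hM =>
        let ⟨p, h0, h1⟩ := TQL.exists_nontrivial_projection hM
        ⟨TQL.daseinisation p, TQL.daseinisation_sup_neg_ne_top h0 h1⟩⟩,
    TQL.exists_orderIso_clopens⟩
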